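/- There are absolute constants $c, C > 0$ such that for every positive integer $n$ there is a family of $n$ distinct lines in $\mathbb{R}^3$ whose intersection graph (the vertices are the lines, and two distinct lines are adjacent if and only if they have a common point) is triangle-free, has chromatic number at least $c\,n^{1/15}$, and has independence number at most $C\,n^{14/15}$. -/

import Mathlib

/-- A subset of Euclidean space `ℝ³` is a (straight) line if it is the line through two distinct
points. -/
def IsLine (l : Set (EuclideanSpace ℝ (Fin 3))) : Prop :=
  ∃ p q : EuclideanSpace ℝ (Fin 3), p ≠ q ∧ l = (line[ℝ, p, q] : Set (EuclideanSpace ℝ (Fin 3)))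

/-- The intersection graph of a finite family `F` of sets: the vertices are the members of `F`,
and two distinct members are joined by an edge if they have a point in common. -/
def intersectionGraph {X : Type*} (F : Finset (Set X)) : SimpleGraph {A : Set X // A ∈ F} where
  Adj A B := A ≠ B ∧ (A.1 ∩ B.1).Nonempty
  symm := ⟨fun A B h => ⟨h.1.symm, by rw [Set.inter_comm]; exact h.2⟩⟩
  loopless := ⟨fun _ h => h.1 rfl⟩

/-! Take all lines `y = a * x + b`, `z = a ^ 2 * x + e` with integer parameters in a box. Three
directions `(1, a, a ^ 2)` with distinct `a` are linearly independent, so pairwise meeting lines are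
concurrent, and triangles are few (`card_triangles_le`). In each of `K` parallel planes all lines
pass through one small grid, so every set of lines at least twice as large as the grid contains a
line meeting `K` others (`exists_large_degree`). Such local density leaves few independent sets of a
suitable size (`card_indepSets_le`). A random subfamily therefore has few triangles and, most
likely, no large independent set; deleting one line per triangle finishes
(`exists_triangleFree_subset`). At scale `w` at least `w ^ 30 / 2` lines remain, with independence
number `O(w ^ 28)`, and 28/30 = 14/15. The chromatic bound follows because color classes are
independent. -/

namespace LineFamily

/-! ### Counting independent sets and random sampling in general graphs. -/

section Combinatorics

open Finset
open scoped Classical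

variable {V : Type*} (G : SimpleGraph V)

/-- The independent sets with `m` elements inside `A`. -/
noncomputable def indepSets (m : ℕ) (A : Finset V) : Finset (Finset V) :=
  (A.powersetCard m).filter fun s => G.IsIndepSet (s : Set V)

theorem mem_indepSets {m : ℕ} {A s : Finset V} :
    s ∈ indepSets G m A ↔ (s ⊆ A ∧ #s = m) ∧ G.IsIndepSet (s : Set V) := by
  simp [indepSets]

/-- Removing a vertex from an independent set leaves an independent set in the non-neighbourhood. -/
theorem succ_mul_card_indepSets_le (m : ℕ) (A : Finset V) :
    (m + 1) * #(indepSets G (m + 1) A) ≤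
      ∑ v ∈ A, #(indepSets G m (A.filter fun u => ¬ G.Adj v u)) := by
  have h1 : (m + 1) * #(indepSets G (m + 1) A) =
      ∑ v ∈ A, #((indepSets G (m + 1) A).filter (v ∈ ·)) := by
    simp_rw [card_filter]
    rw [sum_comm, mul_comm, ← smul_eq_mul, ← sum_const]
    refine sum_congr rfl fun s hs => ?_
    obtain ⟨⟨hsA, hsc⟩, -⟩ := (mem_indepSets G).1 hs
    rw [← card_filter, filter_mem_eq_inter, inter_eq_right.2 hsA, hsc]
  rw [h1]
  refine sum_le_sum fun v _ => ?_
  refine card_le_card_of_injOn (fun s => s.erase v) ?_ ?_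
  · intro s hs
    simp only [coe_filter, Set.mem_ofPred_eq, mem_indepSets] at hs
    obtain ⟨⟨⟨hsA, hsc⟩, hi⟩, hv⟩ := hs
    rw [mem_coe, mem_indepSets]
    refine ⟨⟨fun u hu => ?_, by rw [card_erase_of_mem hv, hsc]; rfl⟩,
      hi.mono (by exact_mod_cast erase_subset v s)⟩
    obtain ⟨huv, hus⟩ := mem_erase.1 hu
    exact mem_filter.2 ⟨hsA hus, hi hv hus huv.symm⟩
  · intro s hs t ht hst
    simp only [coe_filter, Set.mem_ofPred_eq] at hs ht
    rw [← insert_erase hs.2, ← insert_erase ht.2]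
    exact congrArg (insert v) hst

variable [Fintype V]

/-- A Kleitman–Winston type bound: if every set of at least `R` vertices contains a vertex with at
least `d` neighbours in the set, then there are few independent sets. -/
theorem card_indepSets_le {R d : ℕ} (hRV : R ≤ Fintype.card V)
    (hG : ∀ S : Finset V, R ≤ #S → ∃ v ∈ S, d ≤ #(S.filter fun u => G.Adj v u))
    (m h : ℕ) (A : Finset V) (hA : #A ≤ h * d) :
    m.factorial * #(indepSets G m A) * R ^ h ≤ (2 * R) ^ m * Fintype.card V ^ h := by
  induction m generalizing A h with
  | zero =>
    have h1 : #(indepSets G 0 A) ≤ 1 := by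
      refine (card_filter_le _ _).trans ?_
      simp
    calc _ ≤ 1 * R ^ h := by
          gcongr
          simpa using h1
      _ ≤ _ := by
        simp only [one_mul, pow_zero]
        gcongr
  | succ m ih =>
    -- Build independent sets vertex by vertex. A vertex of `low` has at most `R` choices; any other
    -- has at most `Fintype.card V` choices but removes at least `d` vertices from `A`, which the
    -- budget `h` allows only `h` times. The factor `2 ^ m` pays for the two cases at each step.
    set low := A.filter fun v => #(A.filter fun u => G.Adj v u) < d with hlow
    have hlowc : #low ≤ R := by
      by_contra! hlt
      obtain ⟨v, hv, hdv⟩ := hG low hlt.le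
      have := (mem_filter.1 hv).2
      have h2 : #(low.filter fun u => G.Adj v u) ≤ #(A.filter fun u => G.Adj v u) :=
        card_le_card (filter_subset_filter _ (filter_subset _ _))
      omega
    have key : ∀ v ∈ A, m.factorial * #(indepSets G m (A.filter fun u => ¬ G.Adj v u)) * R ^ h ≤
        (if v ∈ low then (2 * R) ^ m * Fintype.card V ^ h else 0) +
          (2 * R) ^ m * R * Fintype.card V ^ (h - 1) := by
      intro v hv
      split_ifs with hvl
      · exact (ih h _ ((card_le_card (filter_subset _ _)).trans hA)).trans (Nat.le_add_right _ _)
      · have hdv : d ≤ #(A.filter fun u => G.Adj v u) := by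
          by_contra! hlt
          exact hvl (mem_filter.2 ⟨hv, hlt⟩)
        have hsum := card_filter_add_card_filter_not (s := A) (fun u => G.Adj v u)
        obtain _ | k := h
        · simp only [zero_mul, nonpos_iff_eq_zero, card_eq_zero] at hA
          simp [hA] at hv
        · rw [Nat.add_sub_cancel, pow_succ, ← mul_assoc, zero_add]
          have := ih k (A.filter fun u => ¬ G.Adj v u) (by rw [add_mul] at hA; omega)
          calc _ ≤ ((2 * R) ^ m * Fintype.card V ^ k) * R := by gcongr
            _ = _ := by ring
    have hAV : #A ≤ Fintype.card V := card_le_univ A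
    calc (m + 1).factorial * #(indepSets G (m + 1) A) * R ^ h
        = m.factorial * ((m + 1) * #(indepSets G (m + 1) A)) * R ^ h := by
          rw [Nat.factorial_succ]; ring
      _ ≤ m.factorial * (∑ v ∈ A, #(indepSets G m (A.filter fun u => ¬ G.Adj v u))) * R ^ h := by
          gcongr
          exact succ_mul_card_indepSets_le G m A
      _ = ∑ v ∈ A, m.factorial * #(indepSets G m (A.filter fun u => ¬ G.Adj v u)) * R ^ h := by
          rw [mul_sum, sum_mul]
      _ ≤ ∑ v ∈ A, ((if v ∈ low then (2 * R) ^ m * Fintype.card V ^ h else 0) +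
          (2 * R) ^ m * R * Fintype.card V ^ (h - 1)) := sum_le_sum key
      _ = #low * ((2 * R) ^ m * Fintype.card V ^ h) +
          #A * ((2 * R) ^ m * R * Fintype.card V ^ (h - 1)) := by
          rw [sum_add_distrib, ← sum_filter, sum_const, sum_const, smul_eq_mul, smul_eq_mul,
            filter_mem_eq_inter, inter_eq_right.2 (filter_subset _ _)]
      _ ≤ R * ((2 * R) ^ m * Fintype.card V ^ h) +
          (2 * R) ^ m * R * Fintype.card V ^ h := by
          refine add_le_add (by gcongr) ?_
          obtain _ | k := h
          · simp only [zero_mul, nonpos_iff_eq_zero] at hA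
            simp [hA]
          · rw [Nat.add_sub_cancel, pow_succ (Fintype.card V)]
            calc _ ≤ Fintype.card V * ((2 * R) ^ m * R * Fintype.card V ^ k) := by gcongr
              _ = _ := by ring
      _ = _ := by ring

/-- The ratio of the binomials is the product of `(M - i) / (N - i)` over `i < t`, and each factor
is at most `M / N`. -/
theorem choose_sub_mul_pow_le {N M : ℕ} (hMN : M ≤ N) (t : ℕ) (ht : t ≤ M) :
    (N - t).choose (M - t) * N ^ t ≤ N.choose M * M ^ t := by
  induction t with
  | zero => simp
  | succ t ih =>
    have h1 := ih (by omega)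
    obtain ⟨a, rfl⟩ : ∃ a, M = a + 1 + t := ⟨M - 1 - t, by omega⟩
    obtain ⟨b, rfl⟩ : ∃ b, N = b + 1 + t := ⟨N - 1 - t, by omega⟩
    rw [show b + 1 + t - t = b + 1 by omega, show a + 1 + t - t = a + 1 by omega] at h1
    rw [show b + 1 + t - (t + 1) = b by omega, show a + 1 + t - (t + 1) = a by omega]
    have h2 := Nat.add_one_mul_choose_eq b a
    have hab : a ≤ b := by omega
    have h3 : (a + 1) * (b + 1 + t) ≤ (b + 1) * (a + 1 + t) := by nlinarith
    have h4 : (b.choose a * (b + 1 + t) ^ (t + 1)) * (b + 1) ≤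
        ((b + 1 + t).choose (a + 1 + t) * (a + 1 + t) ^ (t + 1)) * (b + 1) := by
      calc _ = ((b + 1) * b.choose a) * (b + 1 + t) ^ t * (b + 1 + t) := by ring
        _ = ((b + 1).choose (a + 1) * (b + 1 + t) ^ t) * ((a + 1) * (b + 1 + t)) := by
          rw [h2]; ring
        _ ≤ ((b + 1 + t).choose (a + 1 + t) * (a + 1 + t) ^ t) * ((b + 1) * (a + 1 + t)) := by
          gcongr
        _ = _ := by ring
    exact Nat.le_of_mul_le_mul_right h4 (by omega)

/-- Averaging over all `M`-element sets, a given `t`-element set is contained in at most the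
proportion `(M / N) ^ t` of them. -/
theorem sum_card_filter_subset_mul_le {M t : ℕ} (hM : M ≤ Fintype.card V)
    (𝒮 : Finset (Finset V)) (h𝒮 : ∀ s ∈ 𝒮, #s = t) :
    (∑ W ∈ (univ : Finset V).powersetCard M, #(𝒮.filter (· ⊆ W))) * Fintype.card V ^ t ≤
      #𝒮 * (Fintype.card V).choose M * M ^ t := by
  by_cases ht : t ≤ M
  · have h1 : ∑ W ∈ (univ : Finset V).powersetCard M, #(𝒮.filter (· ⊆ W)) =
        ∑ s ∈ 𝒮, (Fintype.card V - t).choose (M - t) := by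
      simp_rw [card_filter]
      rw [sum_comm]
      refine sum_congr rfl fun s hs => ?_
      rw [← card_filter, card_filter_powersetCard_subset _ _ _ (subset_univ s)
        (by rw [h𝒮 s hs]; exact ht), h𝒮 s hs, card_univ]
    rw [h1, sum_const, smul_eq_mul, mul_assoc, mul_assoc]
    exact Nat.mul_le_mul_left _ (choose_sub_mul_pow_le hM t ht)
  · rw [sum_eq_zero]
    · simp
    · intro W hW
      rw [card_eq_zero, filter_eq_empty_iff]
      intro s hs hsW
      have := card_le_card hsW
      rw [h𝒮 s hs, (mem_powersetCard.1 hW).2] at this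
      exact ht this

/-- If a graph has few triangles and few independent sets of size `m`, then it contains a large
triangle-free induced subgraph without independent sets of size `m`. -/
theorem exists_triangleFree_subset {M m : ℕ} (hM0 : 0 < M) (hM : M ≤ Fintype.card V)
    (htri : 4 * #(G.cliqueFinset 3) * M ^ 2 < Fintype.card V ^ 3)
    (hind : 2 * #(indepSets G m univ) * M ^ m < Fintype.card V ^ m) :
    ∃ W : Finset V, M ≤ 2 * #W ∧
      (∀ s : Finset V, s ⊆ W → ¬ G.IsNClique 3 s) ∧
      (∀ s : Finset V, s ⊆ W → G.IsIndepSet (s : Set V) → #s < m) := by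
  have hchoose : 0 < (Fintype.card V).choose M := Nat.choose_pos hM
  have hV : 0 < Fintype.card V := hM0.trans_le hM
  -- On average there are fewer than `M / 4` triangles and fewer than `1 / 2` independent `m`-sets.
  -- The weight `M` on the latter makes the single inequality force none of them and fewer than `M /
  -- 2` triangles.
  obtain ⟨W, hW, htW⟩ : ∃ W ∈ (univ : Finset V).powersetCard M,
      2 * #((G.cliqueFinset 3).filter (· ⊆ W)) + M * #((indepSets G m univ).filter (· ⊆ W)) < M := by
    by_contra! hcon
    have h1 := sum_le_sum hcon
    rw [sum_const, card_powersetCard, card_univ, smul_eq_mul, sum_add_distrib, ← mul_sum,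
      ← mul_sum] at h1
    have h2 := sum_card_filter_subset_mul_le hM (G.cliqueFinset 3) (t := 3)
      (fun s hs => ((G.mem_cliqueFinset_iff).1 hs).card_eq)
    have h3 := sum_card_filter_subset_mul_le hM (indepSets G m univ) (t := m)
      (fun s hs => ((mem_indepSets G).1 hs).1.2)
    set T := ∑ W ∈ (univ : Finset V).powersetCard M, #((G.cliqueFinset 3).filter (· ⊆ W))
    set I := ∑ W ∈ (univ : Finset V).powersetCard M, #((indepSets G m univ).filter (· ⊆ W))
    set N := Fintype.card V
    have h4 : 4 * T < N.choose M * M := by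
      refine lt_of_mul_lt_mul_right (a := N ^ 3) ?_ (Nat.zero_le _)
      calc 4 * T * N ^ 3 = 4 * (T * N ^ 3) := by ring
        _ ≤ 4 * (#(G.cliqueFinset 3) * N.choose M * M ^ 3) := by gcongr
        _ = (4 * #(G.cliqueFinset 3) * M ^ 2) * (N.choose M * M) := by ring
        _ < N ^ 3 * (N.choose M * M) := by gcongr
        _ = _ := by ring
    have h5 : 2 * I < N.choose M := by
      refine lt_of_mul_lt_mul_right (a := N ^ m) ?_ (Nat.zero_le _)
      calc 2 * I * N ^ m = 2 * (I * N ^ m) := by ring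
        _ ≤ 2 * (#(indepSets G m univ) * N.choose M * M ^ m) := by gcongr
        _ = (2 * #(indepSets G m univ) * M ^ m) * N.choose M := by ring
        _ < N ^ m * N.choose M := by gcongr
        _ = _ := by ring
    nlinarith
  have hI : #((indepSets G m univ).filter (· ⊆ W)) = 0 := by
    by_contra h
    have : M * 1 ≤ M * #((indepSets G m univ).filter (· ⊆ W)) :=
      Nat.mul_le_mul_left _ (Nat.one_le_iff_ne_zero.2 h)
    omega
  set 𝒯 := (G.cliqueFinset 3).filter (· ⊆ W) with h𝒯
  have hne : ∀ s : Finset V, G.IsNClique 3 s → ∃ v, v ∈ s := fun s hs =>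
    card_pos.1 (by rw [hs.card_eq]; norm_num)
  have : Nonempty V := Fintype.card_pos_iff.1 hV
  choose! g hg using hne
  refine ⟨W \ 𝒯.image g, ?_, ?_, ?_⟩
  · have h1 : #(𝒯.image g) ≤ #𝒯 := card_image_le
    have h2 := le_card_sdiff (𝒯.image g) W
    have h3 := (mem_powersetCard.1 hW).2
    omega
  · intro s hs hcl
    have h1 : s ∈ 𝒯 := mem_filter.2 ⟨(G.mem_cliqueFinset_iff).2 hcl, hs.trans sdiff_subset⟩
    exact (mem_sdiff.1 (hs (hg s hcl))).2 (mem_image_of_mem g h1)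
  · intro s hs hi
    by_contra! hlt
    obtain ⟨t, hts, htc⟩ := exists_subset_card_eq hlt
    rw [card_eq_zero, filter_eq_empty_iff] at hI
    refine hI ((mem_indepSets G).2 ⟨⟨subset_univ t, htc⟩, hi.mono (by exact_mod_cast hts)⟩)
      (hts.trans (hs.trans sdiff_subset))

/-- Use `x ^ k / k! ≤ exp x` at `x = k = 3 * h`, together with `e < 3`. -/
theorem pow_le_factorial_three_mul (h : ℕ) : h ^ (3 * h) ≤ (3 * h).factorial := by
  have h1 := Real.pow_div_factorial_le_exp (x := (3 * h : ℕ)) (by positivity) (3 * h)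
  have h2 : Real.exp ((3 * h : ℕ) : ℝ) ≤ 3 ^ (3 * h) := by
    rw [← Real.exp_one_pow]
    gcongr
    exact Real.exp_one_lt_three.le
  rw [div_le_iff₀ (by positivity)] at h1
  have h3 : (3 : ℝ) ^ (3 * h) * (h : ℝ) ^ (3 * h) ≤ 3 ^ (3 * h) * ((3 * h).factorial : ℝ) := by
    rw [← mul_pow]
    refine le_trans ?_ (h1.trans (mul_le_mul_of_nonneg_right h2 (by positivity)))
    push_cast
    exact le_rfl
  exact_mod_cast le_of_mul_le_mul_left h3 (by positivity)

/-- Locally dense graphs have few independent sets of size `3 * h`. -/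
theorem two_mul_card_indepSets_mul_pow_lt {R d h M : ℕ} (hR : 0 < R) (hRV : R ≤ Fintype.card V) (hh : 0 < h)
    (hG : ∀ S : Finset V, R ≤ #S → ∃ v ∈ S, d ≤ #(S.filter fun u => G.Adj v u))
    (hV : Fintype.card V ≤ h * d)
    (hnum : 32 * R ^ 2 * M ^ 3 ≤ Fintype.card V ^ 2 * h ^ 3) :
    2 * #(indepSets G (3 * h) univ) * M ^ (3 * h) < Fintype.card V ^ (3 * h) := by
  have hV0 := hR.trans_le hRV
  have h1 := card_indepSets_le G hRV hG (3 * h) h univ (by rwa [card_univ])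
  set N := Fintype.card V
  set I := #(indepSets G (3 * h) univ)
  have h2 : I * h ^ (3 * h) * R ^ h ≤ (8 * R ^ 2 * N) ^ h * R ^ h := by
    calc I * h ^ (3 * h) * R ^ h = h ^ (3 * h) * I * R ^ h := by ring
      _ ≤ (3 * h).factorial * I * R ^ h := by
        gcongr
        exact pow_le_factorial_three_mul h
      _ ≤ _ := h1
      _ = _ := by
        rw [pow_mul, ← mul_pow, ← mul_pow]
        congr 1
        ring
  have h3 : I * h ^ (3 * h) ≤ (8 * R ^ 2 * N) ^ h := Nat.le_of_mul_le_mul_right h2 (by positivity)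
  -- The 32 in `hnum` is 8 · 4: the 8 comes from `(2 * R) ^ 3`, and the 4 makes the expected number
  -- of independent sets at most `4 ^ (-h)`, below `1 / 2`.
  have h4 : (4 ^ h * I * M ^ (3 * h)) * h ^ (3 * h) ≤ N ^ (3 * h) * h ^ (3 * h) := by
    calc (4 ^ h * I * M ^ (3 * h)) * h ^ (3 * h) = 4 ^ h * (I * h ^ (3 * h)) * M ^ (3 * h) := by ring
      _ ≤ 4 ^ h * (8 * R ^ 2 * N) ^ h * M ^ (3 * h) := by gcongr
      _ = ((32 * R ^ 2 * M ^ 3) * N) ^ h := by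
        rw [pow_mul, ← mul_pow, ← mul_pow]
        congr 1
        ring
      _ ≤ ((N ^ 2 * h ^ 3) * N) ^ h := by gcongr
      _ = _ := by
        rw [pow_mul, pow_mul, ← mul_pow]
        congr 1
        ring
  have h5 : 4 ^ h * I * M ^ (3 * h) ≤ N ^ (3 * h) := Nat.le_of_mul_le_mul_right h4 (by positivity)
  have h6 : 4 ≤ 4 ^ h := Nat.le_self_pow hh.ne' 4
  have h7 : 4 * (I * M ^ (3 * h)) ≤ N ^ (3 * h) := by
    refine le_trans ?_ h5
    rw [mul_assoc]
    gcongr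
  have h8 : 0 < N ^ (3 * h) := by positivity
  rw [mul_assoc]
  omega

end Combinatorics

/-! ### The incidence graph of the lines: triangles, degrees, choice of parameters. -/

section LineGraph

open Finset
open scoped Classical

/-- Parameters `(a, b, e)` of the lines `y = a * x + b`, `z = a ^ 2 * x + e`, in the ranges
`a < A`, `b < A * K`, `e < A ^ 2 * K`. -/
abbrev Param (A K : ℕ) : Type := Fin A × Fin (A * K) × Fin (A ^ 2 * K)

/-- The algebraic condition for the two lines to be distinct and to meet. -/
def paramGraph (A K : ℕ) : SimpleGraph (Param A K) where
  Adj u v := u.1 ≠ v.1 ∧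
    (u.2.2 : ℤ) - v.2.2 = ((u.1 : ℤ) + v.1) * ((u.2.1 : ℤ) - v.2.1)
  symm := ⟨fun u v h => ⟨h.1.symm, by linear_combination -h.2⟩⟩
  loopless := ⟨fun _ h => h.1 rfl⟩

theorem card_param (A K : ℕ) : Fintype.card (Param A K) = A ^ 4 * K ^ 2 := by
  simp only [Fintype.card_prod, Fintype.card_fin]
  ring

/-- Pairwise meeting lines of the family are concurrent, so a triangle is determined by its first
vertex, two parameters of its second vertex and the direction of its third vertex. -/
theorem card_triangles_le (A K : ℕ) :
    #((paramGraph A K).cliqueFinset 3) ≤ A ^ 4 * K ^ 2 * (A ^ 3 * K) := by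
  have hex : ∀ s ∈ (paramGraph A K).cliqueFinset 3, ∃ t : Param A K × Param A K × Param A K,
      (paramGraph A K).Adj t.1 t.2.1 ∧ (paramGraph A K).Adj t.1 t.2.2 ∧
      (paramGraph A K).Adj t.2.1 t.2.2 ∧ s = {t.1, t.2.1, t.2.2} := by
    intro s hs
    obtain ⟨a, b, c, h1, h2, h3, h4⟩ :=
      SimpleGraph.is3Clique_iff.1 (((paramGraph A K).mem_cliqueFinset_iff).1 hs)
    exact ⟨(a, b, c), h1, h2, h3, h4⟩
  choose g hg using fun s : (paramGraph A K).cliqueFinset 3 => hex s.1 s.2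
  have hcard : Fintype.card (Param A K × (Fin A × Fin (A * K)) × Fin A) =
      A ^ 4 * K ^ 2 * (A ^ 3 * K) := by
    rw [Fintype.card_prod, card_param]
    simp only [Fintype.card_prod, Fintype.card_fin]
    ring
  rw [← hcard, ← Fintype.card_coe]
  refine Fintype.card_le_of_injective
    (fun s => ((g s).1, ((g s).2.1.1, (g s).2.1.2.1), (g s).2.2.1)) ?_
  intro s t hst
  obtain ⟨h12, h13, h23, hs4⟩ := hg s
  obtain ⟨k12, k13, k23, ht4⟩ := hg t
  refine Subtype.ext ?_
  rw [hs4, ht4]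
  rcases hgs : g s with ⟨⟨a1, b1, e1⟩, ⟨a2, b2, e2⟩, ⟨a3, b3, e3⟩⟩
  rcases hgt : g t with ⟨⟨a1', b1', e1'⟩, ⟨a2', b2', e2'⟩, ⟨a3', b3', e3'⟩⟩
  simp only [hgs, hgt, Prod.mk.injEq] at hst h12 h13 h23 k12 k13 k23
  obtain ⟨⟨rfl, rfl, rfl⟩, ⟨rfl, rfl⟩, rfl⟩ := hst
  simp only [paramGraph] at h12 h13 h23 k12 k13 k23
  have he2 : e2 = e2' := by
    have : (e2 : ℤ) = e2' := by linear_combination k12.2 - h12.2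
    exact Fin.ext (by exact_mod_cast this)
  subst he2
  have hne : ((a1 : ℕ) : ℤ) - (a2 : ℕ) ≠ 0 := fun h0 =>
    h12.1 (Fin.ext (by exact_mod_cast sub_eq_zero.1 h0))
  -- Concurrency: the third line passes through the common point of the first two, so its direction
  -- fixes it.
  have hb3 : b3 = b3' := by
    have : ((a1 : ℤ) - a2) * ((b3 : ℤ) - b3') = 0 := by
      linear_combination h13.2 - h23.2 - k13.2 + k23.2
    have := (mul_eq_zero.1 this).resolve_left hne
    exact Fin.ext (by exact_mod_cast sub_eq_zero.1 this)
  subst hb3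
  have he3 : e3 = e3' := by
    have : (e3 : ℤ) = e3' := by linear_combination k13.2 - h13.2
    exact Fin.ext (by exact_mod_cast this)
  subst he3
  rfl

/-- Cauchy–Schwarz: the number of coincidences of a map from `S` to a finite type. -/
theorem sq_card_le_card_mul_coincidences {α β : Type*} [Fintype β] (f : α → β) (S : Finset α) :
    #S ^ 2 ≤ Fintype.card β * ∑ v ∈ S, #(S.filter fun u => f u = f v) := by
  have h1 : #S = ∑ b : β, #(S.filter fun u => f u = b) :=
    card_eq_sum_card_fiberwise fun _ _ => mem_coe.2 (mem_univ _)
  have h2 : ∑ v ∈ S, #(S.filter fun u => f u = f v) = ∑ b : β, #(S.filter fun u => f u = b) ^ 2 := by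
    rw [← sum_fiberwise_of_maps_to (t := univ) (g := f) (fun _ _ => mem_univ _)]
    refine sum_congr rfl fun b _ => ?_
    rw [sq, ← smul_eq_mul, ← sum_const]
    refine sum_congr rfl fun v hv => ?_
    rw [(mem_filter.1 hv).2]
  rw [h2, ← card_univ]
  nth_rw 1 [h1]
  exact sq_sum_le_card_mul_sum_sq

/-- The coordinates `(y, z)` of the point with first coordinate `x` of the line with the given
parameters. -/
def pointAt {A K : ℕ} (x : Fin K) (v : Param A K) : Fin (2 * (A * K)) × Fin (2 * (A ^ 2 * K)) :=
  (⟨v.1 * x + v.2.1, by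
      have : (v.1 : ℕ) * x ≤ A * K := Nat.mul_le_mul v.1.2.le x.2.le
      have := v.2.1.2
      omega⟩,
    ⟨v.1 ^ 2 * x + v.2.2, by
      have : (v.1 : ℕ) ^ 2 * x ≤ A ^ 2 * K :=
        Nat.mul_le_mul (Nat.pow_le_pow_left v.1.2.le 2) x.2.le
      have := v.2.2.2
      omega⟩)

theorem adj_of_pointAt_eq {A K : ℕ} {x : Fin K} {u v : Param A K} (huv : u ≠ v)
    (h : pointAt x u = pointAt x v) : (paramGraph A K).Adj v u := by
  simp only [pointAt, Prod.mk.injEq, Fin.mk.injEq] at h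
  obtain ⟨h1, h2⟩ := h
  zify at h1 h2
  refine ⟨fun h0 => huv ?_, ?_⟩
  · rw [h0] at h1 h2
    refine Prod.ext h0.symm (Prod.ext (Fin.ext ?_) (Fin.ext ?_))
    · exact_mod_cast add_left_cancel h1
    · exact_mod_cast add_left_cancel h2
  · linear_combination (-1 : ℤ) * h2 + ((u.1 : ℤ) + v.1) * h1

theorem eq_of_pointAt_eq {A K : ℕ} {x x' : Fin K} {u v : Param A K} (huv : u ≠ v)
    (h : pointAt x u = pointAt x v) (h' : pointAt x' u = pointAt x' v) : x = x' := by
  have hadj := adj_of_pointAt_eq huv h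
  simp only [pointAt, Prod.mk.injEq, Fin.mk.injEq] at h h'
  have h1 := h.1
  have h2 := h'.1
  zify at h1 h2
  have h3 : ((v.1 : ℤ) - u.1) * ((x : ℤ) - x') = 0 := by linear_combination h2 - h1
  have h4 := (mul_eq_zero.1 h3).resolve_left
    (fun h0 => hadj.1 (Fin.ext (by exact_mod_cast sub_eq_zero.1 h0)))
  exact Fin.ext (by exact_mod_cast sub_eq_zero.1 h4)

/-- Large sets of lines contain a line that meets many of the others. -/
theorem exists_large_degree {A K : ℕ} (hA : 0 < A) (hK : 0 < K) (S : Finset (Param A K))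
    (hS : 8 * A ^ 3 * K ^ 2 ≤ #S) :
    ∃ v ∈ S, K ≤ #(S.filter fun u => (paramGraph A K).Adj v u) := by
  by_contra! hcon
  have hS0 : 0 < #S := lt_of_lt_of_le (by positivity) hS
  -- The line `v` coincides with itself once in each of the `K` planes. The other coincidences are
  -- distinct neighbours, since two distinct lines meet in at most one plane `x = const`.
  have hdeg : ∀ v ∈ S, ∑ x : Fin K, #(S.filter fun u => pointAt x u = pointAt x v) < 2 * K := by
    intro v hv
    have h1 : ∀ x : Fin K, #(S.filter fun u => pointAt x u = pointAt x v) =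
        1 + #(S.filter fun u => u ≠ v ∧ pointAt x u = pointAt x v) := by
      intro x
      have : S.filter (fun u => pointAt x u = pointAt x v) =
          insert v (S.filter fun u => u ≠ v ∧ pointAt x u = pointAt x v) := by
        ext u
        simp only [mem_filter, mem_insert]
        by_cases huv : u = v
        · simp [huv, hv]
        · simp [huv]
      rw [this, card_insert_of_notMem (by simp), add_comm]
    have h2 : ∑ x : Fin K, #(S.filter fun u => u ≠ v ∧ pointAt x u = pointAt x v) ≤
        #(S.filter fun u => (paramGraph A K).Adj v u) := by
      rw [← card_biUnion]
      · refine card_le_card fun u hu => ?_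
        obtain ⟨x, -, hx⟩ := mem_biUnion.1 hu
        obtain ⟨huS, huv, hp⟩ := mem_filter.1 hx
        exact mem_filter.2 ⟨huS, adj_of_pointAt_eq huv hp⟩
      · intro x _ y _ hxy
        refine disjoint_left.2 fun u hu hu' => hxy ?_
        obtain ⟨-, huv, hp⟩ := mem_filter.1 hu
        exact eq_of_pointAt_eq huv hp (mem_filter.1 hu').2.2
    simp_rw [h1]
    rw [sum_add_distrib, sum_const, card_univ, Fintype.card_fin, smul_eq_mul, mul_one]
    have := hcon v hv
    omega
  have hup : ∑ v ∈ S, ∑ x : Fin K, #(S.filter fun u => pointAt x u = pointAt x v) <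
      #S * (2 * K) := by
    exact (sum_lt_sum_of_nonempty (card_pos.1 hS0) hdeg).trans_eq (by simp)
  -- Each plane has a grid of `4 * A ^ 3 * K ^ 2` points, at most half of `#S`, so Cauchy–Schwarz
  -- gives at least 2 coincidences per line and plane on average.
  have hlow : K * #S ^ 2 ≤ 4 * A ^ 3 * K ^ 2 *
      ∑ v ∈ S, ∑ x : Fin K, #(S.filter fun u => pointAt x u = pointAt x v) := by
    rw [sum_comm, mul_sum]
    calc K * #S ^ 2 = ∑ _x : Fin K, #S ^ 2 := by simp
      _ ≤ _ := sum_le_sum fun x _ => by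
        refine (sq_card_le_card_mul_coincidences (pointAt x) S).trans_eq ?_
        congr 1
        · simp only [Fintype.card_prod, Fintype.card_fin]
          ring
        · congr!
  have h3 : K * #S ^ 2 < 4 * A ^ 3 * K ^ 2 * (#S * (2 * K)) :=
    hlow.trans_lt (Nat.mul_lt_mul_of_pos_left hup (by positivity))
  have h4 : (K * #S) * #S < (K * #S) * (8 * A ^ 3 * K ^ 2) := by
    calc _ = K * #S ^ 2 := by ring
      _ < _ := h3
      _ = _ := by ring
  exact absurd (lt_of_mul_lt_mul_left h4 (Nat.zero_le _)) (not_lt.2 hS)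

/-- Among the lines with parameters in suitable ranges there is a large triangle-free family with
small independence number. -/
theorem exists_param_family (w : ℕ) (hw : 0 < w) :
    ∃ (A K : ℕ) (W : Finset (Param A K)), w ^ 30 ≤ 2 * #W ∧
      (∀ s : Finset (Param A K), s ⊆ W → ¬ (paramGraph A K).IsNClique 3 s) ∧
      (∀ s : Finset (Param A K), s ⊆ W → (paramGraph A K).IsIndepSet (s : Set (Param A K)) →
        #s < 12288 * w ^ 28) := by
  have hN := card_param (8 * w ^ 3) (w ^ 16)
  have hT := card_triangles_le (8 * w ^ 3) (w ^ 16)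
  -- Here `A = 8 * w ^ 3` and `K = w ^ 16` give `4096 * w ^ 44` lines, and `h = 4096 * w ^ 28` is
  -- this number divided by `d = K`. The powers of `w` balance exactly in the independent-set
  -- condition. The factor 8 in `A` ensures that `R` does not exceed the number of lines, even for
  -- `w = 1`.
  have hmain := exists_triangleFree_subset (paramGraph (8 * w ^ 3) (w ^ 16)) (M := w ^ 30)
    (m := 3 * (4096 * w ^ 28)) (by positivity) ?_ ?_ ?_
  · obtain ⟨W, h1, h2, h3⟩ := hmain
    refine ⟨_, _, W, h1, h2, fun s hs hi => (h3 s hs hi).trans_eq (by ring)⟩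
  · rw [hN]
    calc w ^ 30 ≤ w ^ 44 := Nat.pow_le_pow_right hw (by norm_num)
      _ ≤ 4096 * w ^ 44 := by omega
      _ = _ := by ring
  · rw [hN]
    calc _ ≤ 4 * ((8 * w ^ 3) ^ 4 * (w ^ 16) ^ 2 * ((8 * w ^ 3) ^ 3 * w ^ 16)) * (w ^ 30) ^ 2 := by
          refine Nat.mul_le_mul_right _ (Nat.mul_le_mul_left _ ?_)
          convert hT
      _ = 8388608 * w ^ 129 := by ring
      _ ≤ 8388608 * w ^ 132 := by gcongr; lia
      _ < 68719476736 * w ^ 132 := by gcongr; norm_num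
      _ = _ := by ring
  · refine two_mul_card_indepSets_mul_pow_lt (R := 8 * (8 * w ^ 3) ^ 3 * (w ^ 16) ^ 2)
      (d := w ^ 16) _ (by positivity) ?_ (by positivity)
      (exists_large_degree (by positivity) (by positivity)) ?_ ?_
    · rw [hN]
      calc _ = 4096 * w ^ 41 := by ring
        _ ≤ 4096 * w ^ 44 := by gcongr; lia
        _ = _ := by ring
    · rw [hN]
      exact le_of_eq (by ring)
    · rw [hN]
      calc _ = 536870912 * w ^ 172 := by ring
        _ ≤ 1152921504606846976 * w ^ 172 := by gcongr; norm_num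
        _ = _ := by ring

end LineGraph

/-! ### Passing from parameters to actual lines in space. -/

section Geometry

/-- The line `y = a * x + b`, `z = a ^ 2 * x + e` in `ℝ³`. -/
noncomputable def paramLine {A K : ℕ} (v : Param A K) : Set (EuclideanSpace ℝ (Fin 3)) :=
  (line[ℝ, !₂[0, ((v.2.1 : ℕ) : ℝ), ((v.2.2 : ℕ) : ℝ)],
    !₂[1, ((v.1 : ℕ) : ℝ) + ((v.2.1 : ℕ) : ℝ), ((v.1 : ℕ) : ℝ) ^ 2 + ((v.2.2 : ℕ) : ℝ)]] :
      Set (EuclideanSpace ℝ (Fin 3)))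

theorem isLine_paramLine {A K : ℕ} (v : Param A K) : IsLine (paramLine v) := by
  refine ⟨_, _, fun h => ?_, rfl⟩
  have := congrArg (fun p : EuclideanSpace ℝ (Fin 3) => p 0) h
  simp at this

theorem mem_paramLine {A K : ℕ} (v : Param A K) (p : EuclideanSpace ℝ (Fin 3)) :
    p ∈ paramLine v ↔ p 1 = ((v.1 : ℕ) : ℝ) * p 0 + ((v.2.1 : ℕ) : ℝ) ∧
      p 2 = ((v.1 : ℕ) : ℝ) ^ 2 * p 0 + ((v.2.2 : ℕ) : ℝ) := by
  rw [paramLine, SetLike.mem_coe, mem_affineSpan_pair_iff_exists_lineMap_eq]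
  constructor
  · rintro ⟨r, rfl⟩
    simp [AffineMap.lineMap_apply]
    constructor <;> ring
  · rintro ⟨h1, h2⟩
    refine ⟨p 0, ?_⟩
    ext i
    fin_cases i
    · simp [AffineMap.lineMap_apply]
    · simp [AffineMap.lineMap_apply, h1]
      ring
    · simp [AffineMap.lineMap_apply, h2]
      ring

theorem paramLine_inter_nonempty_iff {A K : ℕ} {u v : Param A K} (huv : u ≠ v) :
    (paramLine u ∩ paramLine v).Nonempty ↔ (paramGraph A K).Adj u v := by
  constructor
  · rintro ⟨p, hu, hv⟩
    rw [mem_paramLine] at hu hv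
    refine ⟨fun h => huv ?_, ?_⟩
    · obtain ⟨hu1, hu2⟩ := hu
      obtain ⟨hv1, hv2⟩ := hv
      rw [h, hv1] at hu1
      rw [h, hv2] at hu2
      refine Prod.ext h (Prod.ext (Fin.ext ?_) (Fin.ext ?_))
      · exact Nat.cast_injective (R := ℝ) (add_left_cancel hu1).symm
      · exact Nat.cast_injective (R := ℝ) (add_left_cancel hu2).symm
    · have : (((u.2.2 : ℕ) : ℝ) - ((v.2.2 : ℕ) : ℝ)) =
          (((u.1 : ℕ) : ℝ) + ((v.1 : ℕ) : ℝ)) * (((u.2.1 : ℕ) : ℝ) - ((v.2.1 : ℕ) : ℝ)) := by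
        linear_combination hv.2 - hu.2 + (((u.1 : ℕ) : ℝ) + ((v.1 : ℕ) : ℝ)) * (hu.1 - hv.1)
      exact_mod_cast this
  · rintro ⟨h1, h2⟩
    have hne : ((u.1 : ℕ) : ℝ) - ((v.1 : ℕ) : ℝ) ≠ 0 := fun h0 =>
      h1 (Fin.ext (by exact_mod_cast sub_eq_zero.1 h0))
    have h3 : (((u.2.2 : ℕ) : ℝ) - ((v.2.2 : ℕ) : ℝ)) =
        (((u.1 : ℕ) : ℝ) + ((v.1 : ℕ) : ℝ)) * (((u.2.1 : ℕ) : ℝ) - ((v.2.1 : ℕ) : ℝ)) := by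
      exact_mod_cast h2
    -- Equating the `y`-coordinates gives this `x`; the `z`-coordinates then agree because `a ^ 2 -
    -- a' ^ 2 = (a - a') * (a + a')`.
    set x : ℝ := -(((u.2.1 : ℕ) : ℝ) - ((v.2.1 : ℕ) : ℝ)) / (((u.1 : ℕ) : ℝ) - ((v.1 : ℕ) : ℝ))
    have hx : (((u.1 : ℕ) : ℝ) - ((v.1 : ℕ) : ℝ)) * x =
        -(((u.2.1 : ℕ) : ℝ) - ((v.2.1 : ℕ) : ℝ)) := mul_div_cancel₀ _ hne
    refine ⟨!₂[x, ((u.1 : ℕ) : ℝ) * x + ((u.2.1 : ℕ) : ℝ),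
      ((u.1 : ℕ) : ℝ) ^ 2 * x + ((u.2.2 : ℕ) : ℝ)], ?_, ?_⟩
    · rw [mem_paramLine]
      simp
    · rw [mem_paramLine]
      simp only [Matrix.cons_val_zero, Matrix.cons_val_one, Matrix.cons_val]
      constructor
      · linear_combination hx
      · linear_combination h3 + (((u.1 : ℕ) : ℝ) + ((v.1 : ℕ) : ℝ)) * hx

theorem paramLine_injective {A K : ℕ} : Function.Injective (paramLine (A := A) (K := K)) := by
  intro u v huv
  have h0 : !₂[0, ((u.2.1 : ℕ) : ℝ), ((u.2.2 : ℕ) : ℝ)] ∈ paramLine v := by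
    rw [← huv, mem_paramLine]
    simp
  have h1 : !₂[1, ((u.1 : ℕ) : ℝ) + ((u.2.1 : ℕ) : ℝ),
      ((u.1 : ℕ) : ℝ) ^ 2 + ((u.2.2 : ℕ) : ℝ)] ∈ paramLine v := by
    rw [← huv, mem_paramLine]
    simp
  rw [mem_paramLine] at h0 h1
  simp only [Matrix.cons_val_zero, Matrix.cons_val_one, Matrix.cons_val,
    mul_zero, zero_add, mul_one] at h0 h1
  rw [h0.1] at h1
  refine Prod.ext (Fin.ext ?_) (Prod.ext (Fin.ext ?_) (Fin.ext ?_))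
  · exact_mod_cast add_right_cancel h1.1
  · exact_mod_cast h0.1
  · exact_mod_cast h0.2

end Geometry

/-! ### Chromatic number versus independence number. -/

section Coloring

open Finset

/-- Color classes are independent. -/
theorem card_le_mul_indepNum_of_coloring {V : Type*} [Fintype V] (G : SimpleGraph V) {k : ℕ}
    (c : G.Coloring (Fin k)) : Fintype.card V ≤ k * G.indepNum := by
  classical
  have h1 : #(univ : Finset V) = ∑ b : Fin k, #(univ.filter fun u => c u = b) :=
    card_eq_sum_card_fiberwise fun _ _ => mem_coe.2 (mem_univ _)
  rw [← card_univ, h1]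
  calc _ ≤ ∑ _b : Fin k, G.indepNum := sum_le_sum fun b _ => by
        refine SimpleGraph.IsIndepSet.card_le_indepNum (G := G) ?_
        intro u hu v hv _ hadj
        simp only [coe_filter, mem_univ, true_and, Set.mem_ofPred_eq] at hu hv
        exact c.valid hadj (hu.trans hv.symm)
    _ = _ := by simp

end Coloring

/-! ### Families with exactly `n` lines. -/

section Family

open Finset
open scoped Classical

/-- A family of `n` lines with the required properties, up to the choice of the scale `w`. -/
theorem exists_line_family (n w : ℕ) (hw : 0 < w) (hn : 2 * n ≤ w ^ 30) :
    ∃ F : Finset (Set (EuclideanSpace ℝ (Fin 3))), #F = n ∧ (∀ l ∈ F, IsLine l) ∧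
      (intersectionGraph F).CliqueFree 3 ∧
      (intersectionGraph F).indepNum ≤ 12288 * w ^ 28 := by
  obtain ⟨A, K, W, hW, htri, hind⟩ := exists_param_family w hw
  -- Both properties pass to subfamilies, so surplus lines can be discarded.
  obtain ⟨U, hUW, hU⟩ := exists_subset_card_eq (show n ≤ #W by omega)
  set F := U.image paramLine with hF
  have hpre : ∀ l : {l // l ∈ F}, ∃ u ∈ U, paramLine u = l.1 := fun l => mem_image.1 l.2
  choose g hgU hg using hpre
  have hginj : Function.Injective g := fun l l' h => Subtype.ext (by rw [← hg l, ← hg l', h])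
  have hadj : ∀ l l', (intersectionGraph F).Adj l l' ↔ (paramGraph A K).Adj (g l) (g l') := by
    intro l l'
    by_cases hll : l = l'
    · subst hll
      simp
    · rw [← paramLine_inter_nonempty_iff (hginj.ne hll), hg, hg]
      exact ⟨fun h => h.2, fun h => ⟨hll, h⟩⟩
  have hsub : ∀ s : Finset {l // l ∈ F}, s.image g ⊆ W := fun s u hu => by
    obtain ⟨l, -, rfl⟩ := mem_image.1 hu
    exact hUW (hgU l)
  refine ⟨F, ?_, ?_, ?_, ?_⟩
  · rw [hF, card_image_of_injective _ paramLine_injective, hU]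
  · intro l hl
    obtain ⟨u, -, rfl⟩ := mem_image.1 hl
    exact isLine_paramLine u
  · intro s hs
    refine htri _ (hsub s) ⟨?_, by rw [card_image_of_injective _ hginj, hs.card_eq]⟩
    rw [coe_image]
    rintro _ ⟨l, hl, rfl⟩ _ ⟨l', hl', rfl⟩ hne
    exact (hadj l l').1 (hs.isClique hl hl' fun h => hne (h ▸ rfl))
  · obtain ⟨s, hs⟩ := (intersectionGraph F).exists_isNIndepSet_indepNum
    rw [← hs.card_eq, ← card_image_of_injective s hginj]
    refine (hind _ (hsub s) ?_).le
    rw [coe_image]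
    rintro _ ⟨l, hl, rfl⟩ _ ⟨l', hl', rfl⟩ hne h
    exact hs.isIndepSet hl hl' (fun h => hne (h ▸ rfl)) ((hadj l l').2 h)

theorem exists_scale (n : ℕ) (hn : 0 < n) :
    ∃ w : ℕ, 0 < w ∧ 2 * n ≤ w ^ 30 ∧ w ^ 30 ≤ 2 ^ 31 * n := by
  have hex : ∃ w : ℕ, 2 * n ≤ w ^ 30 := ⟨2 * n, Nat.le_self_pow (by norm_num) _⟩
  set w := Nat.find hex with hwdef
  have hspec : 2 * n ≤ w ^ 30 := Nat.find_spec hex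
  -- This gives `w ≤ 2 * (w - 1)`, so minimality of `w` bounds `w ^ 30` with a loss of only `2 ^
  -- 30`.
  have hw2 : 2 ≤ w := by
    by_contra! hlt
    have : w ^ 30 ≤ 1 ^ 30 := Nat.pow_le_pow_left (by omega) 30
    omega
  have hmin : (w - 1) ^ 30 < 2 * n := not_le.1 (Nat.find_min hex (by omega))
  refine ⟨w, by omega, hspec, ?_⟩
  calc w ^ 30 ≤ (2 * (w - 1)) ^ 30 := Nat.pow_le_pow_left (by omega) 30
    _ = 2 ^ 30 * (w - 1) ^ 30 := mul_pow _ _ _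
    _ ≤ 2 ^ 30 * (2 * n) := by gcongr
    _ = _ := by ring

end Family

theorem pow_le_rpow_of_pow_le {w n : ℕ} (h : w ^ 30 ≤ 2 ^ 31 * n) :
    ((w ^ 28 : ℕ) : ℝ) ≤ 2 ^ 31 * (n : ℝ) ^ (14 / 15 : ℝ) := by
  have h1 : ((w : ℝ) ^ 30) ≤ 2 ^ 31 * n := by exact_mod_cast h
  have h2 : ((w : ℝ) ^ 30) ^ (14 / 15 : ℝ) = (w : ℝ) ^ 28 := by
    rw [← Real.rpow_natCast, ← Real.rpow_natCast, ← Real.rpow_mul (by positivity)]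
    norm_num
  push_cast
  rw [← h2]
  calc _ ≤ ((2 : ℝ) ^ 31 * n) ^ (14 / 15 : ℝ) := Real.rpow_le_rpow (by positivity) h1 (by norm_num)
    _ = ((2 : ℝ) ^ 31) ^ (14 / 15 : ℝ) * (n : ℝ) ^ (14 / 15 : ℝ) :=
      Real.mul_rpow (by positivity) (by positivity)
    _ ≤ _ := by
      gcongr
      exact Real.rpow_le_self_of_one_le (by norm_num) (by norm_num)

end LineFamily

theorem theorem1 :
    ∃ c C : ℝ, 0 < c ∧ 0 < C ∧ ∀ n : ℕ, 0 < n →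
      ∃ F : Finset (Set (EuclideanSpace ℝ (Fin 3))),
        F.card = n ∧ (∀ l ∈ F, IsLine l) ∧
        (intersectionGraph F).CliqueFree 3 ∧
        (∃ χ : ℕ, (intersectionGraph F).chromaticNumber = χ ∧ c * (n : ℝ) ^ (1 / 15 : ℝ) ≤ χ) ∧
        ((intersectionGraph F).indepNum : ℝ) ≤ C * (n : ℝ) ^ (14 / 15 : ℝ) := by
  -- Taking `c = 1 / C` works since `n ≤ χ * α` and `n` is the product of its powers 1/15 and 14/15.
  refine ⟨1 / (12288 * 2 ^ 31), 12288 * 2 ^ 31, by norm_num, by norm_num, fun n hn => ?_⟩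
  obtain ⟨w, hw, hnw, hwn⟩ := LineFamily.exists_scale n hn
  obtain ⟨F, hF, hline, htri, hind⟩ := LineFamily.exists_line_family n w hw hnw
  have hα : ((intersectionGraph F).indepNum : ℝ) ≤
      12288 * 2 ^ 31 * (n : ℝ) ^ (14 / 15 : ℝ) := by
    calc ((intersectionGraph F).indepNum : ℝ) ≤ ((12288 * w ^ 28 : ℕ) : ℝ) := by exact_mod_cast hind
      _ = 12288 * ((w ^ 28 : ℕ) : ℝ) := by push_cast; ring
      _ ≤ 12288 * (2 ^ 31 * (n : ℝ) ^ (14 / 15 : ℝ)) := by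
        gcongr
        exact LineFamily.pow_le_rpow_of_pow_le hwn
      _ = _ := by ring
  refine ⟨F, hF, hline, htri, ?_, hα⟩
  obtain ⟨χ, hχ⟩ := ENat.ne_top_iff_exists.1
    (SimpleGraph.chromaticNumber_ne_top_iff_exists.2
      ⟨_, (intersectionGraph F).colorable_of_fintype⟩)
  refine ⟨χ, hχ.symm, ?_⟩
  obtain ⟨col⟩ := SimpleGraph.chromaticNumber_le_iff_colorable.1 hχ.symm.le
  have h1 := LineFamily.card_le_mul_indepNum_of_coloring _ col
  rw [Fintype.card_coe, hF] at h1
  have hn' : (0 : ℝ) < n := by exact_mod_cast hn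
  have h2 : (n : ℝ) ≤ χ * (12288 * 2 ^ 31 * (n : ℝ) ^ (14 / 15 : ℝ)) :=
    calc (n : ℝ) ≤ χ * ((intersectionGraph F).indepNum : ℝ) := by exact_mod_cast h1
      _ ≤ _ := by gcongr
  have h3 : (n : ℝ) = (n : ℝ) ^ (1 / 15 : ℝ) * (n : ℝ) ^ (14 / 15 : ℝ) := by
    rw [← Real.rpow_add hn']
    norm_num
  have h4 : (0 : ℝ) < (n : ℝ) ^ (14 / 15 : ℝ) := by positivity
  have h5 : (n : ℝ) ^ (1 / 15 : ℝ) ≤ χ * (12288 * 2 ^ 31) := by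
    refine le_of_mul_le_mul_right ?_ h4
    rw [← h3]
    linarith
  rw [div_mul_eq_mul_div, one_mul, div_le_iff₀ (by norm_num)]
  exact h5
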